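/- For $\rho>0$ and $\mu,z\in\mathbb C$ let $E_{\rho,\mu}(z)=\sum_{n=0}^\infty z^n/\Gamma(\mu+n/\rho)$ be the two-parameter Mittag-Leffler function (with $1/\Gamma=0$ at the poles of $\Gamma$). **Theorem.** Let $\rho,\delta_{1\rho},\delta_{2\rho},\epsilon$ be real numbers with $\rho>1/2$, $\frac{\pi}{2\rho}<\delta_{1\rho}\le\min(\pi,\pi/\rho)$, $\frac{\pi}{2\rho}<\delta_{2\rho}\le\min(\pi,\pi/\rho)$ and $\epsilon>0$, and let $\mu\in\mathbb C$. Let $z\in\mathbb C\setminus\{0\}$ have a value $\arg z\in\mathbb R$ of its argument with $$\frac{\pi}{2\rho}-\delta_{2\rho}+\pi<\arg z<-\frac{\pi}{2\rho}+\delta_{1\rho}+\pi .$$ Then the series defining $E_{\rho,\mu}(z)$ converges absolutely, and $$E_{\rho,\mu}(z)=\frac{\rho}{2\pi i}\int_{\gamma_\zeta}\frac{\exp\{(z\zeta)^\rho\}\,(z\zeta)^{\rho(1-\mu)}}{\zeta-1}\,d\zeta ,$$ where the integral converges absolutely. Here the contour $\gamma_\zeta$ consists of the half-line $S_1=\{\zeta:\arg\zeta=-\delta_{1\rho}-\pi,\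 |\zeta|\ge1+\epsilon\}$, the arc $C_\epsilon=\{\zeta:-\delta_{1\rho}-\pi\le\arg\zeta\le\delta_{2\rho}-\pi,\ |\zeta|=1+\epsilon\}$ and the half-line $S_2=\{\zeta:\arg\zeta=\delta_{2\rho}-\pi,\ |\zeta|\ge1+\epsilon\}$. It is traversed from infinity along $S_1$, then along $C_\epsilon$ in the direction of increasing argument, then to infinity along $S_2$. The powers are $(z\zeta)^a=\exp\{a(\ln|z\zeta|+i(\arg z+\arg\zeta))\}$, with $\arg z$ as above and $\arg\zeta$ as prescribed on the contour (arguments are not reduced modulo $2\pi$). -/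

import Mathlib

/-- The two-parameter Mittag-Leffler function `E_{ρ,μ}(z) = ∑ₙ zⁿ / Γ(μ + n/ρ)`.
(At a pole of `Γ` the term is `0`, in accordance with `1/Γ = 0` there.) -/
noncomputable def mittagLeffler (ρ : ℝ) (μ z : ℂ) : ℂ :=
  ∑' n : ℕ, z ^ n / Complex.Gamma (μ + (n : ℂ) / (ρ : ℂ))

/-- `θ` is a value of the (multivalued) argument of `z`; it exists only for `z ≠ 0`. -/
def IsArgument (z : ℂ) (θ : ℝ) : Prop :=
  z ≠ 0 ∧ z = (‖z‖ : ℂ) * Complex.exp ((θ : ℂ) * Complex.I)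

/-- The complex number with modulus `r` and argument `φ`. -/
noncomputable def polarPoint (r φ : ℝ) : ℂ :=
  (r : ℂ) * Complex.exp ((φ : ℂ) * Complex.I)

/-- The power `w ^ a = exp (a (log r + i φ))` of the point `w` of the Riemann surface of the
logarithm with modulus `r > 0` and argument `φ`; the argument is any real number and is not
reduced modulo `2π`. -/
noncomputable def polarPow (r φ : ℝ) (a : ℂ) : ℂ :=
  Complex.exp (a * ((Real.log r : ℂ) + (φ : ℂ) * Complex.I))

/-- The integral over the loop made of the ray `arg ζ = α`, `|ζ| ≥ R` (traversed from infinity),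
the arc `α ≤ arg ζ ≤ β`, `|ζ| = R` (traversed with increasing argument) and the ray
`arg ζ = β`, `|ζ| ≥ R` (traversed to infinity). The integrand `F` is given as a function of the
modulus and the argument of `ζ`. -/
noncomputable def loopIntegral (R α β : ℝ) (F : ℝ → ℝ → ℂ) : ℂ :=
  -(∫ r in Set.Ioi R, F r α * Complex.exp ((α : ℂ) * Complex.I))
    + (∫ φ in α..β, F R φ * (Complex.I * polarPoint R φ))
    + ∫ r in Set.Ioi R, F r β * Complex.exp ((β : ℂ) * Complex.I)

/-- The integral over the same loop converges absolutely. -/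
def LoopIntegrable (R α β : ℝ) (F : ℝ → ℝ → ℂ) : Prop :=
  MeasureTheory.IntegrableOn
      (fun r : ℝ => F r α * Complex.exp ((α : ℂ) * Complex.I)) (Set.Ioi R) ∧
    IntervalIntegrable
      (fun φ : ℝ => F R φ * (Complex.I * polarPoint R φ)) MeasureTheory.volume α β ∧
    MeasureTheory.IntegrableOn
      (fun r : ℝ => F r β * Complex.exp ((β : ℂ) * Complex.I)) (Set.Ioi R)

/-- The function `exp {(zζ)^ρ} (zζ)^{ρ(1-μ)} / (ζ - 1)` of the point `ζ` with modulus `r` and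
argument `φ`, where `θ` is the argument of `z`, so that `zζ` has modulus `|z| r` and
argument `θ + φ`. -/
noncomputable def mittagLefflerIntegrand (ρ : ℝ) (μ z : ℂ) (θ : ℝ) (r φ : ℝ) : ℂ :=
  Complex.exp (polarPow (‖z‖ * r) (θ + φ) (ρ : ℂ)) *
      polarPow (‖z‖ * r) (θ + φ) ((ρ : ℂ) * (1 - μ)) /
    (polarPoint r φ - 1)

/-! On the contour `|ζ| ≥ 1 + ε > 1`, so `1 / (ζ - 1) = ∑ ζ ^ (-n-1)` converges geometrically and
may be integrated term by term (`integrable_and_hasSum_integral_div_sub_one`). Absolute convergence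
of the series comes out of the same argument.

In the coordinate `u = ρ log (zζ)` the `n`-th term becomes `z ^ n / ρ` times the Hankel integral of
`exp (e ^ u + (1 - a) u)` with `a = μ + n / ρ`, over two horizontal half-lines joined by a vertical
segment. The sector for `arg z` and the bounds on the angles place the half-lines at heights in
`(-3π/2, -π/2)` and `(π/2, 3π/2)`. There `cos` is negative, the integrand decays doubly
exponentially, and `hankel_formula` gives `2πi / Γ(a)`.

Hankel's formula itself is treated through integrals over vertical segments. By Cauchy's theorem the
loop integral is their limit as the abscissa tends to `+∞`. Pieces of segment where `cos < 0`
contribute nothing in the limit, so the heights may be moved to `±π`. For `Re a < 1` the loop is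
collapsed onto the two sides of the cut, which leads to Euler's integral and the reflection formula;
a recurrence in `a` then reaches all other `a`. -/

open MeasureTheory Filter Topology

/-! ### Decay of the Hankel integrand -/

/-- The integrand `exp (e ^ u + (1 - a) u)` of the Hankel integral `∫ e ^ s s ^ (-a) ds` in the
logarithmic coordinate `s = e ^ u`. -/
noncomputable def hankelIntegrand (a u : ℂ) : ℂ :=
  Complex.exp (Complex.exp u + (1 - a) * u)

theorem differentiable_hankelIntegrand (a : ℂ) : Differentiable ℂ (hankelIntegrand a) := by
  unfold hankelIntegrand
  fun_prop

theorem continuous_hankelIntegrand (a : ℂ) : Continuous (hankelIntegrand a) :=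
  (differentiable_hankelIntegrand a).continuous

theorem norm_hankelIntegrand (a : ℂ) (x y : ℝ) :
    ‖hankelIntegrand a (x + y * Complex.I)‖
      = Real.exp (Real.exp x * Real.cos y + (1 - a.re) * x + a.im * y) := by
  rw [hankelIntegrand, Complex.norm_exp]
  congr 1
  simp [Complex.exp_re]
  ring

theorem eventually_mul_sub_exp_le_neg {k : ℝ} (hk : 0 < k) (p : ℝ) :
    ∀ᶠ x : ℝ in atTop, p * x - k * Real.exp x ≤ -x := by
  have h := (Real.isLittleO_pow_exp_atTop (n := 1)).bound (c := k / (|p + 1| + 1)) (by positivity)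
  filter_upwards [h, eventually_ge_atTop 0] with x hx h0
  rw [pow_one, Real.norm_of_nonneg h0, Real.norm_of_nonneg (Real.exp_pos x).le,
    div_mul_eq_mul_div, le_div_iff₀ (by positivity)] at hx
  nlinarith [le_abs_self (p + 1)]

theorem isBigO_hankelIntegrand (a : ℂ) {y : ℝ} (hy : Real.cos y < 0) :
    (fun x : ℝ => hankelIntegrand a (x + y * Complex.I)) =O[atTop]
      fun x => Real.exp (-1 * x) := by
  refine Asymptotics.IsBigO.of_bound (Real.exp (a.im * y)) ?_
  filter_upwards [eventually_mul_sub_exp_le_neg (neg_pos.2 hy) (1 - a.re)] with x hx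
  rw [norm_hankelIntegrand, Real.norm_of_nonneg (Real.exp_pos _).le, ← Real.exp_add]
  exact Real.exp_le_exp.2 (by linarith)

theorem integrableOn_hankelIntegrand (a : ℂ) {y : ℝ} (hy : Real.cos y < 0) (c : ℝ) :
    IntegrableOn (fun x : ℝ => hankelIntegrand a (x + y * Complex.I)) (Set.Ioi c) := by
  have hc : Continuous fun x : ℝ => hankelIntegrand a (x + y * Complex.I) :=
    (continuous_hankelIntegrand a).comp (by fun_prop)
  refine (integrable_norm_iff hc.aestronglyMeasurable).1 ?_
  exact integrable_of_isBigO_exp_neg one_pos hc.norm.continuousOn (isBigO_hankelIntegrand a hy).norm_left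

theorem tendsto_hankelIntegrand (a : ℂ) {y : ℝ} (hy : Real.cos y < 0) :
    Tendsto (fun x : ℝ => hankelIntegrand a (x + y * Complex.I)) atTop (𝓝 0) := by
  refine (isBigO_hankelIntegrand a hy).trans_tendsto ?_
  simpa using Real.tendsto_exp_neg_atTop_nhds_zero

/-! ### Vertical segments and the Hankel loop -/

/-- The integral of the Hankel integrand over the vertical segment from `x + iα` to `x + iβ`. -/
noncomputable def hankelSegment (a : ℂ) (α β x : ℝ) : ℂ :=
  Complex.I * ∫ y in α..β, hankelIntegrand a (x + y * Complex.I)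

theorem intervalIntegrable_hankelIntegrand (a : ℂ) (α β x : ℝ) :
    IntervalIntegrable (fun y : ℝ => hankelIntegrand a (x + y * Complex.I)) volume α β :=
  ((continuous_hankelIntegrand a).comp (by fun_prop)).intervalIntegrable _ _

theorem hankelSegment_add (a : ℂ) (α β γ x : ℝ) :
    hankelSegment a α β x + hankelSegment a β γ x = hankelSegment a α γ x := by
  rw [hankelSegment, hankelSegment, hankelSegment, ← mul_add,
    intervalIntegral.integral_add_adjacent_intervals (intervalIntegrable_hankelIntegrand ..)
      (intervalIntegrable_hankelIntegrand ..)]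

theorem norm_hankelSegment_le (a : ℂ) (α β x k : ℝ)
    (hk : ∀ y ∈ Set.uIcc α β, Real.cos y ≤ k) :
    ‖hankelSegment a α β x‖ ≤
      Real.exp (Real.exp x * k + (1 - a.re) * x + |a.im| * max |α| |β|) * |β - α| := by
  rw [hankelSegment, norm_mul, Complex.norm_I, one_mul]
  refine intervalIntegral.norm_integral_le_of_norm_le_const fun y hy => ?_
  have hy' := Set.uIoc_subset_uIcc hy
  rw [norm_hankelIntegrand]
  refine Real.exp_le_exp.2 (add_le_add_three ?_ le_rfl ?_)
  · exact mul_le_mul_of_nonneg_left (hk y hy') (Real.exp_pos x).le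
  · refine (le_abs_self _).trans ?_
    rw [abs_mul]
    refine mul_le_mul_of_nonneg_left ?_ (abs_nonneg _)
    rw [Set.mem_uIcc] at hy'
    rcases hy' with h | h
    · exact abs_le_max_abs_abs h.1 h.2
    · rw [max_comm]
      exact abs_le_max_abs_abs h.1 h.2

theorem tendsto_hankelSegment_zero (a : ℂ) {α β : ℝ}
    (h : ∀ y ∈ Set.uIcc α β, Real.cos y < 0) :
    Tendsto (hankelSegment a α β) atTop (𝓝 0) := by
  obtain ⟨y₀, hy₀, hmax⟩ := isCompact_uIcc.exists_isMaxOn Set.nonempty_uIcc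
    (Real.continuous_cos.continuousOn (s := Set.uIcc α β))
  set M := |a.im| * max |α| |β|
  have hlim : Tendsto (fun x : ℝ => Real.exp (-x) * (Real.exp M * |β - α|)) atTop (𝓝 0) := by
    simpa using Real.tendsto_exp_neg_atTop_nhds_zero.mul_const (Real.exp M * |β - α|)
  refine squeeze_zero_norm' ?_ hlim
  filter_upwards [eventually_mul_sub_exp_le_neg (neg_pos.2 (h y₀ hy₀)) (1 - a.re)] with x hx
  refine (norm_hankelSegment_le a α β x _ fun y hy => hmax hy).trans ?_
  rw [← mul_assoc, ← Real.exp_add]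
  exact mul_le_mul_of_nonneg_right (Real.exp_le_exp.2 (by simp only [M]; linarith)) (abs_nonneg _)

/-- Cauchy's theorem on the rectangle with opposite corners `c + iα` and `x + iβ`; the integrand is
entire. -/
theorem hankelSegment_eq (a : ℂ) (α β c x : ℝ) :
    hankelSegment a α β x =
      -(∫ t in c..x, hankelIntegrand a (t + α * Complex.I)) + hankelSegment a α β c
        + ∫ t in c..x, hankelIntegrand a (t + β * Complex.I) := by
  have h := Complex.integral_boundary_rect_eq_zero_of_differentiableOn (hankelIntegrand a)
    (c + α * Complex.I) (x + β * Complex.I) (differentiable_hankelIntegrand a).differentiableOn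
  simp only [Complex.add_re, Complex.ofReal_re, Complex.mul_re, Complex.I_re, mul_zero,
    Complex.ofReal_im, Complex.I_im, mul_one, sub_self, add_zero, Complex.add_im, Complex.mul_im,
    zero_add, smul_eq_mul] at h
  simp only [hankelSegment]
  linear_combination h

/-- The Hankel loop integral is the limit of the integrals over vertical segments. -/
theorem tendsto_hankelSegment (a : ℂ) {α β : ℝ} (hα : Real.cos α < 0) (hβ : Real.cos β < 0)
    (c : ℝ) :
    Tendsto (hankelSegment a α β) atTop
      (𝓝 (-(∫ t in Set.Ioi c, hankelIntegrand a (t + α * Complex.I)) + hankelSegment a α β c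
        + ∫ t in Set.Ioi c, hankelIntegrand a (t + β * Complex.I))) := by
  have h : ∀ y : ℝ, Real.cos y < 0 → Tendsto
      (fun x : ℝ => ∫ t in c..x, hankelIntegrand a (t + y * Complex.I)) atTop
      (𝓝 (∫ t in Set.Ioi c, hankelIntegrand a (t + y * Complex.I))) := fun y hy =>
    intervalIntegral_tendsto_integral_Ioi c (integrableOn_hankelIntegrand a hy c) tendsto_id
  exact (((h α hα).neg.add_const _).add (h β hβ)).congr fun x => (hankelSegment_eq a α β c x).symm

/-- As `x → -∞`, `exp (e ^ x)` stays bounded while `e ^ ((1 - Re a) x)` tends to `0`. -/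
theorem tendsto_atBot_hankelSegment {a : ℂ} (ha : a.re < 1) (α β : ℝ) :
    Tendsto (hankelSegment a α β) atBot (𝓝 0) := by
  have h1 : Tendsto (fun x : ℝ => (1 - a.re) * x) atBot atBot :=
    tendsto_id.const_mul_atBot (by linarith)
  set M := |a.im| * max |α| |β|
  have h2 : Tendsto (fun x : ℝ => Real.exp (Real.exp x) * Real.exp ((1 - a.re) * x)
      * (Real.exp M * |β - α|)) atBot (𝓝 0) := by
    have := ((Real.continuous_exp.tendsto 0).comp Real.tendsto_exp_atBot).mul
      (Real.tendsto_exp_atBot.comp h1)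
    simpa using this.mul_const (Real.exp M * |β - α|)
  refine squeeze_zero_norm (fun x => ?_) h2
  refine (norm_hankelSegment_le a α β x 1 fun y _ => Real.cos_le_one y).trans_eq ?_
  rw [mul_one, Real.exp_add, Real.exp_add]
  ring

/-! ### Hankel's formula with both rays on the cut -/

/-- Euler's integral for `Γ` under the substitution `s = e ^ t`. -/
theorem integrable_and_integral_exp_neg_exp {b : ℂ} (hb : 0 < b.re) :
    Integrable (fun t : ℝ => Complex.exp (-Complex.exp t + b * t)) ∧
      ∫ t : ℝ, Complex.exp (-Complex.exp t + b * t) = Complex.Gamma b := by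
  have hd : ∀ t ∈ (Set.univ : Set ℝ), HasDerivWithinAt Real.exp (Real.exp t) Set.univ t :=
    fun t _ => (Real.hasDerivAt_exp t).hasDerivWithinAt
  have himg : Real.exp '' Set.univ = Set.Ioi 0 := by rw [Set.image_univ, Real.range_exp]
  have hfun : ∀ t : ℝ, |Real.exp t| • ((Real.exp (-Real.exp t) : ℂ) * (Real.exp t : ℂ) ^ (b - 1))
      = Complex.exp (-Complex.exp t + b * t) := fun t => by
    rw [abs_of_pos (Real.exp_pos t), Complex.real_smul,
      Complex.cpow_def_of_ne_zero (by exact_mod_cast (Real.exp_pos t).ne'),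
      ← Complex.ofReal_log (Real.exp_pos t).le, Real.log_exp]
    push_cast
    rw [← Complex.exp_add, ← Complex.exp_add]
    congr 1
    ring
  constructor
  · have h := (integrableOn_image_iff_integrableOn_abs_deriv_smul MeasurableSet.univ hd
      Real.exp_injective.injOn
      (fun x : ℝ => (Real.exp (-x) : ℂ) * (x : ℂ) ^ (b - 1))).1
        (himg ▸ Complex.GammaIntegral_convergent hb)
    simp only [hfun] at h
    exact integrableOn_univ.1 h
  · have h := integral_image_eq_integral_abs_deriv_smul MeasurableSet.univ hd
      Real.exp_injective.injOn
      (fun x : ℝ => (Real.exp (-x) : ℂ) * (x : ℂ) ^ (b - 1))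
    simp only [hfun, himg, Measure.restrict_univ] at h
    rw [← h, Complex.Gamma_eq_integral hb, Complex.GammaIntegral]

theorem hankelIntegrand_add_pi (a : ℂ) (t : ℝ) :
    hankelIntegrand a (t + (Real.pi : ℝ) * Complex.I)
      = Complex.exp ((1 - a) * (Real.pi * Complex.I))
        * Complex.exp (-Complex.exp t + (1 - a) * t) := by
  rw [hankelIntegrand, Complex.exp_add (t : ℂ), Complex.exp_pi_mul_I, ← Complex.exp_add]
  congr 1
  ring

theorem hankelIntegrand_sub_pi (a : ℂ) (t : ℝ) :
    hankelIntegrand a (t + (-Real.pi : ℝ) * Complex.I)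
      = Complex.exp (-((1 - a) * (Real.pi * Complex.I)))
        * Complex.exp (-Complex.exp t + (1 - a) * t) := by
  rw [hankelIntegrand, Complex.exp_add (t : ℂ), Complex.ofReal_neg, neg_mul, Complex.exp_neg,
    Complex.exp_pi_mul_I, ← Complex.exp_add]
  congr 1
  ring

/-- Letting `c → -∞` kills the segment and leaves two full-line Euler integrals with phases `e ^
(±iπ(1 - a))`. Their difference is `2i sin(πa) Γ(1 - a)`, which is `2πi / Γ(a)` by reflection. -/
theorem tendsto_hankelSegment_pi_of_re_lt_one {a : ℂ} (ha : a.re < 1) :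
    Tendsto (hankelSegment a (-Real.pi) Real.pi) atTop
      (𝓝 (2 * Real.pi * Complex.I * (Complex.Gamma a)⁻¹)) := by
  have hb : 0 < (1 - a).re := by simpa using ha
  obtain ⟨hint, hval⟩ := integrable_and_integral_exp_neg_exp hb
  have hcos : Real.cos Real.pi < 0 := by simp
  have hcos' : Real.cos (-Real.pi) < 0 := by simp
  have hlim := tendsto_hankelSegment a hcos' hcos
  have key : ∀ c : ℝ, -(∫ t in Set.Ioi c, hankelIntegrand a (t + (-Real.pi : ℝ) * Complex.I))
      + hankelSegment a (-Real.pi) Real.pi c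
      + ∫ t in Set.Ioi c, hankelIntegrand a (t + (Real.pi : ℝ) * Complex.I)
      = 2 * Real.pi * Complex.I * (Complex.Gamma a)⁻¹ := fun c => by
    -- The loop value is a limit that does not involve `c`, hence is constant in `c` and can be
    -- computed at `c → -∞`.
    have h1 := (tendsto_const_nhds (f := atBot)).congr fun c' => tendsto_nhds_unique (hlim c) (hlim c')
    have h2 : Integrable fun t : ℝ => hankelIntegrand a (t + (-Real.pi : ℝ) * Complex.I) := by
      simp only [hankelIntegrand_sub_pi]
      exact hint.const_mul _
    have h3 : Integrable fun t : ℝ => hankelIntegrand a (t + (Real.pi : ℝ) * Complex.I) := by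
      simp only [hankelIntegrand_add_pi]
      exact hint.const_mul _
    have h4 := (((aecover_Ioi (μ := volume) tendsto_id).integral_tendsto_of_countably_generated
      h2).neg.add (tendsto_atBot_hankelSegment ha (-Real.pi) Real.pi)).add
      ((aecover_Ioi tendsto_id).integral_tendsto_of_countably_generated h3)
    rw [tendsto_nhds_unique h1 h4]
    simp only [hankelIntegrand_sub_pi, hankelIntegrand_add_pi, integral_const_mul, hval]
    have hG := Complex.Gamma_mul_Gamma_one_sub a
    have hne := Complex.Gamma_ne_zero_of_re_pos hb
    have hsin : Complex.exp ((1 - a) * (Real.pi * Complex.I))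
        - Complex.exp (-((1 - a) * (Real.pi * Complex.I)))
        = 2 * Complex.I * Complex.sin (Real.pi * a) := by
      have h5 : Complex.sin (Real.pi * a) = Complex.sin (Real.pi * (1 - a)) := by
        rw [mul_sub, mul_one, Complex.sin_pi_sub]
      rw [h5, Complex.sin, show -((1 - a) * (Real.pi * Complex.I))
        = -(Real.pi * (1 - a)) * Complex.I by ring, show (1 - a) * (Real.pi * Complex.I)
        = (Real.pi * (1 - a)) * Complex.I by ring]
      linear_combination (Complex.exp ((Real.pi * (1 - a)) * Complex.I)
        - Complex.exp (-(Real.pi * (1 - a)) * Complex.I)) * Complex.I_sq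
    have hlhs : -(Complex.exp (-((1 - a) * (Real.pi * Complex.I))) * Complex.Gamma (1 - a)) + 0
        + Complex.exp ((1 - a) * (Real.pi * Complex.I)) * Complex.Gamma (1 - a)
        = 2 * Complex.I * (Complex.sin (Real.pi * a) * Complex.Gamma (1 - a)) := by
      linear_combination Complex.Gamma (1 - a) * hsin
    rw [hlhs]
    -- If `sin(πa) = 0`, reflection forces the default value `Γ(a) = 0` of a pole, and its inverse
    -- `0` is the correct value of `1 / Γ`.
    by_cases hs : Complex.sin (Real.pi * a) = 0
    · rw [hs, div_zero] at hG
      rw [(mul_eq_zero.1 hG).resolve_right hne, hs]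
      simp
    · have hGa : Complex.Gamma a ≠ 0 := by
        intro h0
        rw [h0, zero_mul, eq_comm, div_eq_zero_iff] at hG
        exact hG.elim (by exact_mod_cast Real.pi_ne_zero) hs
      field_simp
      rw [eq_div_iff hs] at hG
      linear_combination hG
  simpa only [key] using hlim 0

/-- The value `a = 1` is out of reach of the recurrence, which divides by `a - 1`. Here the
integrand is `2πi`-periodic, so the rays cancel and the segment integral does not depend on `x`; as
`x → -∞` the integrand tends to `1`. -/
theorem tendsto_hankelSegment_pi_one :
    Tendsto (hankelSegment 1 (-Real.pi) Real.pi) atTop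
      (𝓝 (2 * Real.pi * Complex.I * (Complex.Gamma 1)⁻¹)) := by
  have hconst : ∀ c x, hankelSegment 1 (-Real.pi) Real.pi c
      = hankelSegment 1 (-Real.pi) Real.pi x := fun c x => by
    rw [hankelSegment_eq 1 (-Real.pi) Real.pi c x]
    simp only [hankelIntegrand_sub_pi, hankelIntegrand_add_pi]
    simp
  have hlim : Tendsto (hankelSegment 1 (-Real.pi) Real.pi) atBot
      (𝓝 (2 * Real.pi * Complex.I * (Complex.Gamma 1)⁻¹)) := by
    rw [tendsto_iff_norm_sub_tendsto_zero]
    have h0 : Tendsto (fun x => 2 * Real.exp x * |Real.pi - -Real.pi|) atBot (𝓝 0) := by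
      simpa using (Real.tendsto_exp_atBot.const_mul 2).mul_const |Real.pi - -Real.pi|
    refine squeeze_zero' (.of_forall fun _ => norm_nonneg _) ?_ h0
    filter_upwards [eventually_le_atBot 0] with x hx
    have h1 : hankelSegment 1 (-Real.pi) Real.pi x
        - 2 * Real.pi * Complex.I * (Complex.Gamma 1)⁻¹
        = Complex.I * ∫ y in (-Real.pi)..Real.pi, (hankelIntegrand 1 (x + y * Complex.I) - 1) := by
      rw [intervalIntegral.integral_sub (intervalIntegrable_hankelIntegrand ..) (by simp),
        mul_sub, ← hankelSegment, intervalIntegral.integral_const, Complex.Gamma_one]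
      simp only [sub_neg_eq_add, Complex.real_smul]
      push_cast
      ring
    rw [h1, norm_mul, Complex.norm_I, one_mul]
    refine intervalIntegral.norm_integral_le_of_norm_le_const fun y _ => ?_
    have h2 : ‖Complex.exp (x + y * Complex.I)‖ = Real.exp x := by
      simp [Complex.norm_exp]
    rw [hankelIntegrand, sub_self, zero_mul, add_zero]
    refine (Complex.norm_exp_sub_one_le ?_).trans_eq ?_
    · rw [h2]
      exact Real.exp_le_one_iff.2 hx
    · rw [h2]
  have h := tendsto_nhds_unique hlim
    (tendsto_const_nhds.congr fun x => hconst 0 x)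
  rw [h]
  exact tendsto_const_nhds.congr fun x => hconst 0 x

/-- The `u`-derivative of the integrand with parameter `a + 1` is the integrand for `a` minus `a`
times the one for `a + 1`. With vanishing boundary terms this mirrors `1 / Γ(a) = a / Γ(a + 1)`. -/
theorem hankelSegment_sub (a : ℂ) (α β x : ℝ) :
    hankelSegment a α β x - a * hankelSegment (a + 1) α β x
      = hankelIntegrand (a + 1) (x + β * Complex.I)
        - hankelIntegrand (a + 1) (x + α * Complex.I) := by
  have hd : ∀ y ∈ Set.uIcc α β, HasDerivAt
      (fun y : ℝ => hankelIntegrand (a + 1) (x + y * Complex.I))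
      (Complex.I * (hankelIntegrand a (x + y * Complex.I)
        - a * hankelIntegrand (a + 1) (x + y * Complex.I))) y := by
    intro y _
    have h1 : HasDerivAt (fun y : ℝ => (x + y * Complex.I : ℂ)) Complex.I y := by
      simpa using ((Complex.ofRealCLM.hasDerivAt (x := y)).mul_const Complex.I).const_add (x : ℂ)
    have h2 := (h1.cexp.add (h1.const_mul (1 - (a + 1)))).cexp
    refine h2.congr_deriv ?_
    have h3 : hankelIntegrand a (x + y * Complex.I)
        = hankelIntegrand (a + 1) (x + y * Complex.I) * Complex.exp (x + y * Complex.I) := by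
      rw [hankelIntegrand, hankelIntegrand, ← Complex.exp_add]
      congr 1
      ring
    rw [h3]
    simp only [hankelIntegrand, Pi.add_apply]
    ring
  have hi := (intervalIntegrable_hankelIntegrand a α β x).sub
    ((intervalIntegrable_hankelIntegrand (a + 1) α β x).const_mul a)
  rw [← intervalIntegral.integral_eq_sub_of_hasDerivAt hd (hi.const_mul _),
    intervalIntegral.integral_const_mul,
    intervalIntegral.integral_sub (intervalIntegrable_hankelIntegrand ..)
      ((intervalIntegrable_hankelIntegrand ..).const_mul a),
    intervalIntegral.integral_const_mul, hankelSegment, hankelSegment]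
  ring

theorem tendsto_hankelSegment_pi (a : ℂ) :
    Tendsto (hankelSegment a (-Real.pi) Real.pi) atTop
      (𝓝 (2 * Real.pi * Complex.I * (Complex.Gamma a)⁻¹)) := by
  -- Induction over the half-planes `Re a < n + 1`, each step passing from `a - 1` to `a`.
  suffices h : ∀ n : ℕ, ∀ a : ℂ, a.re < n + 1 →
      Tendsto (hankelSegment a (-Real.pi) Real.pi) atTop
        (𝓝 (2 * Real.pi * Complex.I * (Complex.Gamma a)⁻¹)) by
    obtain ⟨n, hn⟩ := exists_nat_gt a.re
    exact h n a (by linarith)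
  intro n
  induction n with
  | zero => exact fun a ha => tendsto_hankelSegment_pi_of_re_lt_one (by simpa using ha)
  | succ n ih =>
    intro a ha
    by_cases ha1 : a = 1
    · rw [ha1]
      exact tendsto_hankelSegment_pi_one
    have hne : a - 1 ≠ 0 := sub_ne_zero.2 ha1
    have h1 := ih (a - 1) (by push_cast at ha; simp; linarith)
    have hcos : Real.cos Real.pi < 0 := by simp
    have hcos' : Real.cos (-Real.pi) < 0 := by simp
    have h2 := ((h1.sub ((tendsto_hankelIntegrand a hcos).sub
      (tendsto_hankelIntegrand a hcos'))).const_mul (a - 1)⁻¹)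
    have h3 := Complex.one_div_Gamma_eq_self_mul_one_div_Gamma_add_one (a - 1)
    rw [sub_add_cancel] at h3
    have h4 : (a - 1)⁻¹ * (2 * Real.pi * Complex.I * (Complex.Gamma (a - 1))⁻¹ - (0 - 0))
        = 2 * Real.pi * Complex.I * (Complex.Gamma a)⁻¹ := by
      rw [h3]
      field_simp
      ring
    rw [h4] at h2
    refine h2.congr fun x => ?_
    have h5 := hankelSegment_sub (a - 1) (-Real.pi) Real.pi x
    rw [sub_add_cancel] at h5
    rw [← h5, sub_sub_cancel, inv_mul_cancel_left₀ hne]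

/-- Hankel's formula for `1 / Γ`, in logarithmic coordinates. -/
theorem hankel_formula (a : ℂ) {α β : ℝ} (hα : -(3 * Real.pi / 2) < α) (hα' : α < -(Real.pi / 2))
    (hβ : Real.pi / 2 < β) (hβ' : β < 3 * Real.pi / 2) (c : ℝ) :
    -(∫ t in Set.Ioi c, hankelIntegrand a (t + α * Complex.I)) + hankelSegment a α β c
        + ∫ t in Set.Ioi c, hankelIntegrand a (t + β * Complex.I)
      = 2 * Real.pi * Complex.I * (Complex.Gamma a)⁻¹ := by
  have hcos : ∀ y, Real.pi / 2 < y → y < 3 * Real.pi / 2 → Real.cos y < 0 := fun y h h' =>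
    Real.cos_neg_of_pi_div_two_lt_of_lt h (by linarith)
  have hcos' : ∀ y, -(3 * Real.pi / 2) < y → y < -(Real.pi / 2) → Real.cos y < 0 := fun y h h' =>
    Real.cos_neg y ▸ hcos (-y) (by linarith) (by linarith)
  have hpi := Real.pi_pos
  have h1 : Tendsto (hankelSegment a α (-Real.pi)) atTop (𝓝 0) :=
    tendsto_hankelSegment_zero a fun y hy => by
      rw [Set.mem_uIcc] at hy
      exact hcos' y (by rcases hy with h | h <;> linarith) (by rcases hy with h | h <;> linarith)
  have h2 : Tendsto (hankelSegment a Real.pi β) atTop (𝓝 0) :=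
    tendsto_hankelSegment_zero a fun y hy => by
      rw [Set.mem_uIcc] at hy
      exact hcos y (by rcases hy with h | h <;> linarith) (by rcases hy with h | h <;> linarith)
  -- The segment is cut at `-π` and `π`; `cos < 0` on the two outer pieces, so only the middle one
  -- survives in the limit.
  have h3 := (h1.add (tendsto_hankelSegment_pi a)).add h2
  rw [zero_add, add_zero] at h3
  refine tendsto_nhds_unique
    (tendsto_hankelSegment a (hcos' α hα hα') (hcos β hβ hβ') c) (h3.congr fun x => ?_)
  rw [hankelSegment_add, hankelSegment_add]

/-! ### Termwise integration of the geometric series -/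

/-- The `n`-th term is dominated by `R ^ (-n-1) ‖g‖`, so the integrals of the norms are summable. -/
theorem integrable_and_hasSum_integral_div_sub_one {X : Type*} [MeasurableSpace X] {ν : Measure X}
    {g ζ : X → ℂ} {R : ℝ} (hR : 1 < R) (hg : Integrable g ν) (hζ : AEStronglyMeasurable ζ ν)
    (h : ∀ᵐ x ∂ν, R ≤ ‖ζ x‖) :
    Integrable (fun x => g x / (ζ x - 1)) ν ∧
      HasSum (fun n : ℕ => ∫ x, g x * (ζ x ^ (n + 1))⁻¹ ∂ν) (∫ x, g x / (ζ x - 1) ∂ν) := by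
  have hR0 : 0 < R := one_pos.trans hR
  have hbound : ∀ n : ℕ, ∀ᵐ x ∂ν, ‖g x * (ζ x ^ (n + 1))⁻¹‖ ≤ R⁻¹ ^ (n + 1) * ‖g x‖ := fun n => by
    filter_upwards [h] with x hx
    rw [norm_mul, norm_inv, norm_pow, mul_comm, inv_pow]
    gcongr
  have hmeas : ∀ n : ℕ, AEStronglyMeasurable (fun x => (ζ x ^ (n + 1))⁻¹) ν := fun n =>
    ((hζ.aemeasurable.pow_const (n + 1)).inv).aestronglyMeasurable
  have hint : ∀ n : ℕ, Integrable (fun x => g x * (ζ x ^ (n + 1))⁻¹) ν := fun n =>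
    (hg.norm.const_mul _).mono' (hg.aestronglyMeasurable.mul (hmeas n)) (hbound n)
  have hgeom : Summable fun n : ℕ => R⁻¹ ^ (n + 1) * ∫ x, ‖g x‖ ∂ν :=
    ((summable_geometric_of_lt_one (inv_nonneg.2 hR0.le) (inv_lt_one_of_one_lt₀ hR)).comp_injective
      (add_left_injective 1)).mul_right _
  have hsum : Summable fun n : ℕ => ∫ x, ‖g x * (ζ x ^ (n + 1))⁻¹‖ ∂ν := by
    refine hgeom.of_nonneg_of_le (fun n => integral_nonneg fun x => norm_nonneg _) fun n => ?_
    rw [← integral_const_mul]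
    exact integral_mono_ae (hint n).norm (hg.norm.const_mul _) (hbound n)
  have htsum : (fun x => ∑' n : ℕ, g x * (ζ x ^ (n + 1))⁻¹) =ᵐ[ν] fun x => g x / (ζ x - 1) := by
    filter_upwards [h] with x hx
    have hζ0 : ζ x ≠ 0 := norm_pos_iff.1 (hR0.trans_le hx)
    have hζ1 : ζ x - 1 ≠ 0 := fun h0 => by
      rw [sub_eq_zero.1 h0, norm_one] at hx
      linarith
    have hlt : ‖(ζ x)⁻¹‖ < 1 := by
      rw [norm_inv]
      exact inv_lt_one_of_one_lt₀ (hR.trans_le hx)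
    have h1 : ∀ n : ℕ, g x * (ζ x ^ (n + 1))⁻¹ = g x * (ζ x)⁻¹ * (ζ x)⁻¹ ^ n := fun n => by
      rw [← inv_pow, pow_succ]
      ring
    simp only [h1]
    rw [tsum_mul_left, tsum_geometric_of_norm_lt_one hlt]
    have h2 : 1 - (ζ x)⁻¹ ≠ 0 := by
      have h3 : (1 - (ζ x)⁻¹) * ζ x ≠ 0 := by rwa [sub_mul, inv_mul_cancel₀ hζ0, one_mul]
      exact left_ne_zero_of_mul h3
    field_simp
  refine ⟨?_, ?_⟩
  · refine (hg.norm.const_mul (R - 1)⁻¹).mono' ?_ ?_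
    · exact (hg.aemeasurable.div (hζ.aemeasurable.sub_const 1)).aestronglyMeasurable
    · filter_upwards [h] with x hx
      have h1 : R - 1 ≤ ‖ζ x - 1‖ := by
        have := norm_sub_norm_le (ζ x) 1
        rw [norm_one] at this
        linarith
      have h2 : 0 < R - 1 := by linarith
      rw [norm_div, div_eq_inv_mul]
      gcongr
  · rw [← integral_congr_ae htsum]
    exact hasSum_integral_of_summable_integral_norm hint hsum

/-! ### The Mittag-Leffler integrand in logarithmic coordinates -/

theorem norm_polarPoint {r : ℝ} (hr : 0 ≤ r) (φ : ℝ) : ‖polarPoint r φ‖ = r := by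
  rw [polarPoint, norm_mul, Complex.norm_exp_ofReal_mul_I, mul_one, Complex.norm_real,
    Real.norm_of_nonneg hr]

theorem continuous_polarPoint (r : ℝ) : Continuous (polarPoint r) := by
  unfold polarPoint
  fun_prop

theorem continuous_polarPoint_left (φ : ℝ) : Continuous fun r => polarPoint r φ := by
  unfold polarPoint
  fun_prop

/-- The numerator of the Mittag-Leffler integrand. -/
noncomputable def mittagLefflerNumerator (ρ : ℝ) (μ z : ℂ) (θ r φ : ℝ) : ℂ :=
  Complex.exp (polarPow (‖z‖ * r) (θ + φ) (ρ : ℂ)) *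
    polarPow (‖z‖ * r) (θ + φ) ((ρ : ℂ) * (1 - μ))

/-- With `w = log (zζ)` and `u = ρw`, one has `ζ = e ^ w / z`. The extra factor `ζ` is the Jacobian
of the logarithmic coordinate; together with `ζ ^ (-m)` it shifts the Hankel parameter by `(m - 1) /
ρ`. -/
theorem mittagLefflerNumerator_mul {ρ : ℝ} (hρ : ρ ≠ 0) (μ : ℂ) {z : ℂ} {θ : ℝ}
    (hθ : IsArgument z θ) {r : ℝ} (hr : 0 < r) (φ : ℝ) (m : ℕ) :
    mittagLefflerNumerator ρ μ z θ r φ * polarPoint r φ * (polarPoint r φ ^ m)⁻¹ =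
      z ^ m / z * hankelIntegrand (μ + (m - 1) / ρ)
        ((ρ * Real.log (‖z‖ * r) : ℝ) + (ρ * θ + ρ * φ : ℝ) * Complex.I) := by
  obtain ⟨hz, hz'⟩ := hθ
  have hzn : 0 < ‖z‖ := norm_pos_iff.2 hz
  have hρ' : (ρ : ℂ) ≠ 0 := by exact_mod_cast hρ
  set w : ℂ := (Real.log (‖z‖ * r) : ℂ) + ((θ + φ : ℝ) : ℂ) * Complex.I with hw
  have hζ : polarPoint r φ = Complex.exp w / z := by
    rw [eq_div_iff hz, hw, Complex.exp_add, Complex.ofReal_log (by positivity), Complex.exp_log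
      (by exact_mod_cast (mul_pos hzn hr).ne'), polarPoint]
    conv_lhs => rw [hz']
    push_cast
    rw [add_mul, Complex.exp_add]
    ring
  have harg : ((ρ * Real.log (‖z‖ * r) : ℝ) : ℂ) + ((ρ * θ + ρ * φ : ℝ) : ℂ) * Complex.I
      = ρ * w := by
    rw [hw]
    push_cast
    ring
  rw [harg, hζ, mittagLefflerNumerator, polarPow, polarPow, ← hw, hankelIntegrand, div_pow, inv_div,
    ← Complex.exp_nat_mul]
  have hexp : Complex.exp (Complex.exp (ρ * w) + (1 - (μ + (m - 1) / ρ)) * (ρ * w))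
      = Complex.exp (Complex.exp (ρ * w)) * Complex.exp (ρ * (1 - μ) * w) * Complex.exp w
        / Complex.exp (m * w) := by
    rw [← Complex.exp_add, ← Complex.exp_add, ← Complex.exp_sub]
    congr 1
    field_simp
    ring
  rw [hexp]
  field_simp

/-- Substituting `x = ρ log (κ r)` on a half-line. -/
theorem integrableOn_and_integral_comp_log {ρ κ R : ℝ} (hρ : 0 < ρ) (hκ : 0 < κ) (hR : 0 < R)
    {f : ℝ → ℂ} (hf : IntegrableOn f (Set.Ioi (ρ * Real.log (κ * R)))) :
    IntegrableOn (fun r : ℝ => (r : ℂ)⁻¹ * f (ρ * Real.log (κ * r))) (Set.Ioi R) ∧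
      ∫ r in Set.Ioi R, (r : ℂ)⁻¹ * f (ρ * Real.log (κ * r))
        = (ρ : ℂ)⁻¹ * ∫ x in Set.Ioi (ρ * Real.log (κ * R)), f x := by
  have hρ' : (ρ : ℂ) ≠ 0 := by exact_mod_cast hρ.ne'
  have hd : ∀ r ∈ Set.Ioi R,
      HasDerivWithinAt (fun r => ρ * Real.log (κ * r)) (ρ * r⁻¹) (Set.Ioi R) r := fun r hr => by
    have hr0 : 0 < r := hR.trans hr
    have h1 := (((hasDerivAt_id r).const_mul κ).log (mul_pos hκ hr0).ne').const_mul ρ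
    refine (h1.congr_deriv ?_).hasDerivWithinAt
    simp only [id]
    field_simp
  have hinj : Set.InjOn (fun r => ρ * Real.log (κ * r)) (Set.Ioi R) := fun r hr s hs h => by
    have h1 := mul_left_cancel₀ hρ.ne' h
    exact mul_left_cancel₀ hκ.ne' (Real.log_injOn_pos
      (mul_pos hκ (hR.trans hr)) (mul_pos hκ (hR.trans hs)) h1)
  have himg : (fun r => ρ * Real.log (κ * r)) '' Set.Ioi R = Set.Ioi (ρ * Real.log (κ * R)) := by
    ext x
    constructor
    · rintro ⟨r, hr, rfl⟩
      exact mul_lt_mul_of_pos_left (Real.log_lt_log (by positivity)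
        (mul_lt_mul_of_pos_left hr hκ)) hρ
    · intro hx
      refine ⟨Real.exp (x / ρ) / κ, ?_, ?_⟩
      · rw [Set.mem_Ioi, lt_div_iff₀ hκ, mul_comm, ← Real.log_lt_iff_lt_exp (by positivity),
          lt_div_iff₀ hρ, mul_comm]
        exact hx
      · simp only [mul_div_cancel₀ _ hκ.ne', Real.log_exp]
        field_simp
  have hcongr : Set.EqOn (fun r : ℝ => |ρ * r⁻¹| • f (ρ * Real.log (κ * r)))
      (fun r : ℝ => (ρ : ℂ) * ((r : ℂ)⁻¹ * f (ρ * Real.log (κ * r)))) (Set.Ioi R) := fun r hr => by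
    have hr0 : 0 < r := hR.trans hr
    simp only [abs_of_pos (mul_pos hρ (inv_pos.2 hr0)), Complex.real_smul]
    push_cast
    ring
  constructor
  · rw [← himg, integrableOn_image_iff_integrableOn_abs_deriv_smul measurableSet_Ioi hd hinj,
      integrableOn_congr_fun hcongr measurableSet_Ioi] at hf
    refine (hf.const_mul (ρ : ℂ)⁻¹).congr (.of_forall fun r => ?_)
    simp only [inv_mul_cancel_left₀ hρ']
  · rw [← himg, integral_image_eq_integral_abs_deriv_smul measurableSet_Ioi hd hinj,
      setIntegral_congr_fun measurableSet_Ioi hcongr, integral_const_mul,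
      inv_mul_cancel_left₀ hρ']

theorem integrableOn_and_integral_mittagLefflerNumerator_ray {ρ : ℝ} (hρ : 0 < ρ) (μ : ℂ) {z : ℂ}
    {θ : ℝ} (hθ : IsArgument z θ) {R : ℝ} (hR : 0 < R) {φ : ℝ}
    (hφ : Real.cos (ρ * θ + ρ * φ) < 0) (m : ℕ) :
    IntegrableOn (fun r => mittagLefflerNumerator ρ μ z θ r φ * Complex.exp (φ * Complex.I)
        * (polarPoint r φ ^ m)⁻¹) (Set.Ioi R) ∧
      ∫ r in Set.Ioi R, mittagLefflerNumerator ρ μ z θ r φ * Complex.exp (φ * Complex.I)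
        * (polarPoint r φ ^ m)⁻¹ =
      z ^ m / z * ((ρ : ℂ)⁻¹ * ∫ x in Set.Ioi (ρ * Real.log (‖z‖ * R)),
        hankelIntegrand (μ + (m - 1) / ρ) (x + (ρ * θ + ρ * φ : ℝ) * Complex.I)) := by
  obtain ⟨h1, h2⟩ := integrableOn_and_integral_comp_log hρ (norm_pos_iff.2 hθ.1) hR
    (integrableOn_hankelIntegrand (μ + (m - 1) / ρ) hφ (ρ * Real.log (‖z‖ * R)))
  have hcongr : Set.EqOn
      (fun r => mittagLefflerNumerator ρ μ z θ r φ * Complex.exp (φ * Complex.I)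
        * (polarPoint r φ ^ m)⁻¹)
      (fun r : ℝ => z ^ m / z * ((r : ℂ)⁻¹ * hankelIntegrand (μ + (m - 1) / ρ)
        ((ρ * Real.log (‖z‖ * r) : ℝ) + (ρ * θ + ρ * φ : ℝ) * Complex.I))) (Set.Ioi R) :=
    fun r hr => by
    have hr0 : 0 < r := hR.trans hr
    have hr' : (r : ℂ) ≠ 0 := by exact_mod_cast hr0.ne'
    have h3 := mittagLefflerNumerator_mul hρ.ne' μ hθ hr0 φ m
    have h4 : Complex.exp (φ * Complex.I) = (r : ℂ)⁻¹ * polarPoint r φ := by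
      rw [polarPoint, inv_mul_cancel_left₀ hr']
    simp only [h4]
    linear_combination (r : ℂ)⁻¹ * h3
  constructor
  · rw [integrableOn_congr_fun hcongr measurableSet_Ioi]
    exact h1.const_mul _
  · rw [setIntegral_congr_fun measurableSet_Ioi hcongr, integral_const_mul, h2]

theorem continuous_mittagLefflerNumerator (ρ : ℝ) (μ z : ℂ) (θ r : ℝ) :
    Continuous (mittagLefflerNumerator ρ μ z θ r) := by
  unfold mittagLefflerNumerator polarPow
  fun_prop

theorem integral_mittagLefflerNumerator_arc {ρ : ℝ} (hρ : 0 < ρ) (μ : ℂ) {z : ℂ}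
    {θ : ℝ} (hθ : IsArgument z θ) {R : ℝ} (hR : 0 < R) (α β : ℝ) (m : ℕ) :
    ∫ φ in α..β, mittagLefflerNumerator ρ μ z θ R φ * (Complex.I * polarPoint R φ)
        * (polarPoint R φ ^ m)⁻¹ =
      z ^ m / z * ((ρ : ℂ)⁻¹ * hankelSegment (μ + (m - 1) / ρ) (ρ * θ + ρ * α) (ρ * θ + ρ * β)
        (ρ * Real.log (‖z‖ * R))) := by
  have h : ∀ φ, mittagLefflerNumerator ρ μ z θ R φ * (Complex.I * polarPoint R φ)
      * (polarPoint R φ ^ m)⁻¹ = z ^ m / z * Complex.I * hankelIntegrand (μ + (m - 1) / ρ)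
        ((ρ * Real.log (‖z‖ * R) : ℝ) + (ρ * θ + ρ * φ : ℝ) * Complex.I) := fun φ => by
    linear_combination Complex.I * mittagLefflerNumerator_mul hρ.ne' μ hθ hR φ m
  simp only [h]
  rw [intervalIntegral.integral_const_mul, intervalIntegral.integral_comp_add_mul
    (fun y : ℝ => hankelIntegrand (μ + (m - 1) / ρ)
      ((ρ * Real.log (‖z‖ * R) : ℝ) + y * Complex.I)) hρ.ne', hankelSegment, Complex.real_smul]
  push_cast
  ring

/-! ### Assembly of the contour integral -/

theorem loopIntegrable_and_hasSum_mittagLefflerIntegrand {ρ : ℝ} (hρ : 0 < ρ) (μ : ℂ) {z : ℂ}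
    {θ : ℝ} (hθ : IsArgument z θ) {R : ℝ} (hR : 1 < R) {α β : ℝ} (hαβ : α ≤ β)
    (hα : -(3 * Real.pi / 2) < ρ * θ + ρ * α) (hα' : ρ * θ + ρ * α < -(Real.pi / 2))
    (hβ : Real.pi / 2 < ρ * θ + ρ * β) (hβ' : ρ * θ + ρ * β < 3 * Real.pi / 2) :
    LoopIntegrable R α β (mittagLefflerIntegrand ρ μ z θ) ∧
      HasSum (fun n : ℕ => z ^ n / Complex.Gamma (μ + (n : ℂ) / (ρ : ℂ)))
        (ρ / (2 * Real.pi * Complex.I) *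
          loopIntegral R α β (mittagLefflerIntegrand ρ μ z θ)) := by
  have hR0 : 0 < R := one_pos.trans hR
  have hρ' : (ρ : ℂ) ≠ 0 := by exact_mod_cast hρ.ne'
  have hray : ∀ φ : ℝ, Real.cos (ρ * θ + ρ * φ) < 0 → _ := fun φ hφ =>
    integrable_and_hasSum_integral_div_sub_one (ν := volume.restrict (Set.Ioi R))
      (g := fun r => mittagLefflerNumerator ρ μ z θ r φ * Complex.exp (φ * Complex.I))
      (ζ := fun r => polarPoint r φ) hR
      -- The case `m = 0`, where the factor `ζ ^ (-m)` is `1`, is the integrability of the numerator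
      -- along the ray.
      (by simpa [IntegrableOn] using
        (integrableOn_and_integral_mittagLefflerNumerator_ray hρ μ hθ hR0 hφ 0).1)
      (continuous_polarPoint_left φ).aestronglyMeasurable
      (by
        filter_upwards [ae_restrict_mem measurableSet_Ioi] with r hr
        rw [norm_polarPoint (hR0.trans hr).le]
        exact le_of_lt hr)
  have harc := integrable_and_hasSum_integral_div_sub_one (ν := volume.restrict (Set.Ioc α β))
      (g := fun φ => mittagLefflerNumerator ρ μ z θ R φ * (Complex.I * polarPoint R φ))
      (ζ := polarPoint R) hR
      ((intervalIntegrable_iff_integrableOn_Ioc_of_le hαβ).1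
        (((continuous_mittagLefflerNumerator ρ μ z θ R).mul
          (continuous_const.mul (continuous_polarPoint R))).intervalIntegrable _ _))
      (continuous_polarPoint R).aestronglyMeasurable
      (.of_forall fun φ => (norm_polarPoint hR0.le φ).ge)
  have hcosα : Real.cos (ρ * θ + ρ * α) < 0 := by
    rw [← Real.cos_neg]
    exact Real.cos_neg_of_pi_div_two_lt_of_lt (by linarith) (by linarith)
  have hcosβ : Real.cos (ρ * θ + ρ * β) < 0 :=
    Real.cos_neg_of_pi_div_two_lt_of_lt (by linarith) (by linarith)
  obtain ⟨hα1, hα2⟩ := hray α hcosα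
  obtain ⟨hβ1, hβ2⟩ := hray β hcosβ
  obtain ⟨harc1, harc2⟩ := harc
  have hF : ∀ r φ (t : ℂ), mittagLefflerIntegrand ρ μ z θ r φ * t
      = mittagLefflerNumerator ρ μ z θ r φ * t / (polarPoint r φ - 1) := fun r φ t => by
    rw [mittagLefflerIntegrand, mittagLefflerNumerator, div_mul_eq_mul_div]
  refine ⟨⟨?_, ?_, ?_⟩, ?_⟩
  · simpa only [IntegrableOn, hF] using hα1
  · simpa only [intervalIntegrable_iff_integrableOn_Ioc_of_le hαβ, IntegrableOn, hF] using harc1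
  · simpa only [IntegrableOn, hF] using hβ1
  · have hsum := ((hα2.neg.add harc2).add hβ2).mul_left (ρ / (2 * Real.pi * Complex.I) : ℂ)
    simp only [loopIntegral, hF, intervalIntegral.integral_of_le hαβ]
    refine hsum.congr_fun fun n => ?_
    rw [← intervalIntegral.integral_of_le hαβ, integral_mittagLefflerNumerator_arc hρ μ hθ hR0,
      (integrableOn_and_integral_mittagLefflerNumerator_ray hρ μ hθ hR0 hcosα (n + 1)).2,
      (integrableOn_and_integral_mittagLefflerNumerator_ray hρ μ hθ hR0 hcosβ (n + 1)).2]
    -- The `n`-th geometric term carries `ζ ^ (-(n + 1))`, so `m = n + 1` and the parameter `μ + (m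
    -- - 1) / ρ` is `μ + n / ρ`.
    have hH := hankel_formula (μ + n / ρ) hα hα' hβ hβ' (ρ * Real.log (‖z‖ * R))
    have hz := hθ.1
    have hpi : (Real.pi : ℂ) ≠ 0 := by exact_mod_cast Real.pi_ne_zero
    have hm : ((n + 1 : ℕ) - 1 : ℂ) = n := by
      push_cast
      ring
    rw [hm, pow_succ, mul_div_assoc, div_self hz, mul_one]
    have hI := Complex.I_ne_zero
    rw [div_eq_mul_inv (z ^ n)]
    generalize (Complex.Gamma (μ + n / ρ))⁻¹ = G at hH ⊢
    generalize (∫ t in Set.Ioi (ρ * Real.log (‖z‖ * R)), hankelIntegrand (μ + n / ρ)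
      (t + (ρ * θ + ρ * α : ℝ) * Complex.I)) = A at hH ⊢
    generalize (∫ t in Set.Ioi (ρ * Real.log (‖z‖ * R)), hankelIntegrand (μ + n / ρ)
      (t + (ρ * θ + ρ * β : ℝ) * Complex.I)) = B at hH ⊢
    generalize hankelSegment _ _ _ _ = S at hH ⊢
    field_simp
    linear_combination -hH

theorem theorem1 (ρ δ₁ δ₂ ε : ℝ) (hρ : 1 / 2 < ρ)
    (hδ₁ : Real.pi / (2 * ρ) < δ₁) (hδ₁' : δ₁ ≤ min Real.pi (Real.pi / ρ))
    (hδ₂ : Real.pi / (2 * ρ) < δ₂) (hδ₂' : δ₂ ≤ min Real.pi (Real.pi / ρ))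
    (hε : 0 < ε) (μ z : ℂ) (θ : ℝ) (hθ : IsArgument z θ)
    (hθ₁ : Real.pi / (2 * ρ) - δ₂ + Real.pi < θ)
    (hθ₂ : θ < -(Real.pi / (2 * ρ)) + δ₁ + Real.pi) :
    Summable (fun n : ℕ => z ^ n / Complex.Gamma (μ + (n : ℂ) / (ρ : ℂ))) ∧
      LoopIntegrable (1 + ε) (-δ₁ - Real.pi) (δ₂ - Real.pi)
        (mittagLefflerIntegrand ρ μ z θ) ∧
      mittagLeffler ρ μ z =
        (ρ : ℂ) / (2 * (Real.pi : ℂ) * Complex.I) *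
          loopIntegral (1 + ε) (-δ₁ - Real.pi) (δ₂ - Real.pi)
            (mittagLefflerIntegrand ρ μ z θ) := by
  have hρ0 : 0 < ρ := by linarith
  have hhalf : ρ * (Real.pi / (2 * ρ)) = Real.pi / 2 := by field_simp
  have hpos : 0 < Real.pi / (2 * ρ) := by positivity
  -- From `ρδ₁, ρδ₂ ≤ π` and the sector condition, the ray heights `ρ(θ - δ₁ - π)` and `ρ(θ + δ₂ -
  -- π)` stay within `3π/2` of `0`; the sector condition alone keeps them beyond `∓π/2`.
  have hle : ∀ δ, δ ≤ min Real.pi (Real.pi / ρ) → ρ * δ ≤ Real.pi := fun δ hδ => by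
    have h := (le_div_iff₀ hρ0).1 (hδ.trans (min_le_right _ _))
    linarith
  have h1 := hle δ₁ hδ₁'
  have h2 := hle δ₂ hδ₂'
  have h3 := mul_lt_mul_of_pos_left hθ₁ hρ0
  have h4 := mul_lt_mul_of_pos_left hθ₂ hρ0
  rw [mul_add, mul_sub, hhalf] at h3
  rw [mul_add, mul_add, mul_neg, hhalf] at h4
  obtain ⟨hloop, hsum⟩ := loopIntegrable_and_hasSum_mittagLefflerIntegrand hρ0 μ hθ
    (R := 1 + ε) (α := -δ₁ - Real.pi) (β := δ₂ - Real.pi) (by linarith) (by linarith)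
    (by rw [mul_sub, mul_neg]; linarith) (by rw [mul_sub, mul_neg]; linarith)
    (by rw [mul_sub]; linarith) (by rw [mul_sub]; linarith)
  exact ⟨hsum.summable, hloop, hsum.tsum_eq⟩
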